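/- All graphs are finite and simple. For a set $W$ of vertices of a graph $G=(V,E)$, the graph generated by $W$ is the induced subgraph on $W$, and the unit sphere $S(x)$ of a vertex $x$ is the graph generated by the neighbors of $x$. A one-point graph is contractible, and, inductively, a graph is contractible if it has a vertex $v$ such that both $S(v)$ and the graph without $v$ are contractible. The empty graph is the $(-1)$-sphere; for $k\ge 0$, a $k$-sphere is a graph all of whose unit spheres are $(k-1)$-spheres and which becomes contractible after the removal of some vertex. The inductive dimension is $\dim(\emptyset)=-1$ and $\dim(G)=1+\frac1{|V|}\sum_{x\in V}\dim(S(x))$. The Betti number $b_k(G)$ is the dimension of the $k$-th simplicial cohomology group of $G$ with real coefficients, the $k$-simplices being the complete subgraphs with $k+1$ vertices. Let $f:V\to\mathbb{R}$ be a Morse function on a finite simple graph $G=(V,E)$, meaning that $f(x)\ne f(y)$ whenever $x,y$ are adjacent, and that for every vertex $x$ the graph $S^-_f(x)$ generated by the neighbors $y$ of $x$ with $f(y)<f(x)$ is an $m$-sphere for some $m\ge -1$ (so that every vertex counts as a critical point). The Morse index of $x$ is the dimension of the graph $B^-_f(x)$ generated by $x$ and the vertices of $S^-_f(x)$. Let $c_k$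 be the number of critical points of Morse index $k$. Then the weak Morse inequalities $b_k(G)\le c_k$ hold for all $k\ge 0$. Moreover, each addition of a vertex in the Morse filtration changes exactly one Betti number, and by $\pm1$: if $x$ is a vertex of Morse index $m$, and $W\subset V$ does not contain $x$, contains every $y$ with $f(y)<f(x)$, and satisfies $f(y)\le f(x)$ for all $y\in W$, then on passing from the graph generated by $W$ to the graph generated by $W\cup\{x\}$ either $b_m$ increases by $1$ or ($m\ge1$ and) $b_{m-1}$ decreases by $1$, and all other Betti numbers stay the same. -/

import Mathlib

namespace MorseGraph

variable {V : Type*}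

/-! A set `W` of vertices of `G` stands for the subgraph of `G` generated (induced) by `W`;
the whole graph is `Finset.univ`. Only generated subgraphs occur below. -/

section Spheres

variable (G : SimpleGraph V) [DecidableRel G.Adj]

/-- The unit sphere of `x` in the subgraph generated by `W`: the neighbors of `x` in `W`. -/
def unitSphere (W : Finset V) (x : V) : Finset V := W.filter (fun y => G.Adj x y)

theorem card_unitSphere_lt {W : Finset V} {x : V} (hx : x ∈ W) :
    (unitSphere G W x).card < W.card := by
  refine Finset.card_lt_card ((Finset.filter_ssubset).2 ⟨x, hx, G.irrefl⟩)

/-- The inductive dimension of the subgraph generated by `W`: the empty graph has dimension `-1`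
and otherwise it is one plus the average of the dimensions of the unit spheres. -/
def dim (W : Finset V) : ℚ :=
  if W.card = 0 then -1 else 1 + (∑ x : {x // x ∈ W}, dim (unitSphere G W x.1)) / W.card
termination_by W.card
decreasing_by exact card_unitSphere_lt G x.2

variable [DecidableEq V]

/-- Contractibility of the subgraph generated by `W`: a one-point graph is contractible, and
a graph is contractible if for some vertex `v` both the unit sphere of `v` and the graph
without `v` are contractible. -/
inductive IsContractible : Finset V → Prop
  | point (v : V) : IsContractible {v}
  | step (W : Finset V) (v : V) (hv : v ∈ W)
      (hS : IsContractible (unitSphere G W v)) (hW : IsContractible (W.erase v)) :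
      IsContractible W

/-- `IsSphere G n W`: the subgraph generated by `W` is an Evako `(n - 1)`-sphere
(note the shift by one, so that `n = 0` is the `(-1)`-sphere, the empty graph).
A `k`-sphere with `0 ≤ k` is a graph all of whose unit spheres are `(k - 1)`-spheres and which
becomes contractible after removing some vertex. -/
def IsSphere : ℕ → Finset V → Prop
  | 0, W => W = ∅
  | n + 1, W =>
      (∀ v ∈ W, IsSphere n (unitSphere G W v)) ∧ ∃ v ∈ W, IsContractible G (W.erase v)

end Spheres

section Cohomology

variable (G : SimpleGraph V)

/-- An ordered `k`-simplex of the subgraph generated by `W`: an enumeration of the `k + 1`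
(pairwise adjacent, hence distinct) vertices of a complete subgraph. -/
def OrdSimplex (W : Finset V) (k : ℕ) : Type _ :=
  {s : Fin (k + 1) → V // (∀ i, s i ∈ W) ∧ ∀ i j, i ≠ j → G.Adj (s i) (s j)}

variable {G} in
/-- Renumbering the vertices of an ordered simplex. -/
def OrdSimplex.perm {W : Finset V} {k : ℕ} (s : OrdSimplex G W k)
    (σ : Equiv.Perm (Fin (k + 1))) : OrdSimplex G W k :=
  ⟨fun i => s.1 (σ i), fun i => s.2.1 (σ i),
    fun _ _ h => s.2.2 _ _ (fun e => h (σ.injective e))⟩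

variable {G} in
/-- The face obtained by omitting the `i`-th vertex. -/
def OrdSimplex.face {W : Finset V} {k : ℕ} (s : OrdSimplex G W (k + 1))
    (i : Fin (k + 2)) : OrdSimplex G W k :=
  ⟨fun j => s.1 (i.succAbove j), fun j => s.2.1 (i.succAbove j),
    fun _ _ h => s.2.2 _ _ (fun e => h (Fin.succAbove_right_injective e))⟩

/-- The space `Ω^k` of `k`-forms: real functions on ordered `k`-simplices which change by the
sign of the permutation when the vertices are renumbered. -/
def forms (W : Finset V) (k : ℕ) : Submodule ℝ (OrdSimplex G W k → ℝ) where
  carrier := {ω | ∀ (s : OrdSimplex G W k) (σ : Equiv.Perm (Fin (k + 1))),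
    ω (s.perm σ) = ((Equiv.Perm.sign σ : ℤ) : ℝ) * ω s}
  zero_mem' := by
    intro s σ
    simp
  add_mem' := by
    intro a b ha hb s σ
    simp only [Pi.add_apply, ha s σ, hb s σ]
    ring
  smul_mem' := by
    intro c a ha s σ
    simp only [Pi.smul_apply, smul_eq_mul, ha s σ]
    ring

/-- The exterior derivative
`(d ω)(x_0, …, x_{k+1}) = ∑ i, (-1)^i ω(x_0, …, x_{i-1}, x_{i+1}, …, x_{k+1})`. -/
def exteriorDerivative (W : Finset V) (k : ℕ) :
    (OrdSimplex G W k → ℝ) →ₗ[ℝ] (OrdSimplex G W (k + 1) → ℝ) where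
  toFun ω := fun s => ∑ i : Fin (k + 2), (-1 : ℝ) ^ (i : ℕ) * ω (s.face i)
  map_add' := by
    intro a b
    funext s
    simp only [Pi.add_apply, mul_add, Finset.sum_add_distrib]
  map_smul' := by
    intro c a
    funext s
    simp only [Pi.smul_apply, smul_eq_mul, RingHom.id_apply, Finset.mul_sum]
    refine Finset.sum_congr rfl (fun i _ => ?_)
    ring

/-- The kernel of `d` on `Ω^k`. -/
def cocycles (W : Finset V) (k : ℕ) : Submodule ℝ (OrdSimplex G W k → ℝ) :=
  forms G W k ⊓ LinearMap.ker (exteriorDerivative G W k)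

/-- The image of `Ω^(k-1)` under `d` (zero for `k = 0`). -/
def coboundaries (W : Finset V) : (k : ℕ) → Submodule ℝ (OrdSimplex G W k → ℝ)
  | 0 => ⊥
  | k + 1 => (forms G W k).map (exteriorDerivative G W k)

/-- The `k`-th cohomology group `ker (d | Ω^k) / im (d | Ω^(k-1))` of the subgraph
generated by `W`. -/
abbrev Cohomology (W : Finset V) (k : ℕ) : Type _ :=
  cocycles G W k ⧸ (coboundaries G W k).submoduleOf (cocycles G W k)

/-- The `k`-th Betti number of the subgraph generated by `W`. -/
noncomputable def betti (W : Finset V) (k : ℕ) : ℕ :=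
  Module.finrank ℝ (Cohomology G W k)

end Cohomology

section Morse

variable [Fintype V] [DecidableEq V] (G : SimpleGraph V) [DecidableRel G.Adj] (f : V → ℝ)

/-- The stable sphere `S^-_f(x)`: the neighbors `y` of `x` with `f y < f x`. -/
noncomputable def stableSphere (x : V) : Finset V :=
  (unitSphere G Finset.univ x).filter (fun y => f y < f x)

/-- The stable ball `B^-_f(x)`, generated by `x` and `S^-_f(x)`. -/
noncomputable def stableBall (x : V) : Finset V := insert x (stableSphere G f x)

/-- `x` is a critical point at which a handle is attached: the graph `S^-_f(x)` is an Evako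
`m`-sphere for some `m ≥ -1`. -/
def IsCritical (x : V) : Prop := ∃ n : ℕ, IsSphere G n (stableSphere G f x)

/-- A Morse function: locally injective, and every stable sphere is an Evako sphere. -/
def IsMorse : Prop := (∀ x y, G.Adj x y → f x ≠ f y) ∧ ∀ x, IsCritical G f x

/-- The Morse index of `x`: the dimension of the stable ball. -/
noncomputable def morseIndex (x : V) : ℚ := dim G (stableBall G f x)

/-- The number `c_k` of critical points of Morse index `k`. -/
noncomputable def criticalCount (k : ℕ) : ℕ :=
  Set.ncard {x : V | IsCritical G f x ∧ morseIndex G f x = k}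

end Morse

end MorseGraph

/-! Adding `x` to the graph generated by `W` glues a cone along the unit sphere `S` of `x` in `W`.
Cochains of the enlarged graph that vanish on `W` are, by contraction with `x`, the cochains of `S`
in one degree lower, where the empty simplex counts as a simplex. The long exact sequence of the
pair therefore involves only the reduced cohomology of `W`, of `S` and of the enlarged graph. It is
used as a count of dimensions (`exists_reducedBetti_insert`): the unknowns `e n` are the ranks of
the connecting maps, each bounded by the reduced Betti number of `S`.

The same count computes the reduced cohomology of contractible graphs (zero) and of Evako spheres
(one-dimensional, in the top degree only). If `S` is a sphere, at most one `e n` is nonzero, and it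
is 0 or 1: either a new class appears or a class one degree lower dies (`exists_betti_insert`).

Local injectivity of `f` identifies `S` with the stable sphere, and the cone formula `dim_insert`
identifies the Morse index with the degree of the possible new class. The weak inequalities follow
by adding the vertices in order of nondecreasing `f`. -/

namespace MorseGraph

variable {V : Type*}

/-! ### Alternating functions of tuples, weighted differentials and contraction -/

section Cochains

/-- Invariance up to sign under renumbering of the arguments. -/
def IsAlternating {n : ℕ} (ω : (Fin n → V) → ℝ) : Prop :=
  ∀ (s : Fin n → V) (σ : Equiv.Perm (Fin n)),
    ω (fun i => s (σ i)) = ((Equiv.Perm.sign σ : ℤ) : ℝ) * ω s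

/-- The differential on functions of tuples, weighted by a function of the omitted entry. -/
def tupleDiff (w : V → ℝ) (n : ℕ) :
    ((Fin n → V) → ℝ) →ₗ[ℝ] ((Fin (n + 1) → V) → ℝ) where
  toFun ω := fun s => ∑ i : Fin (n + 1), (-1 : ℝ) ^ (i : ℕ) * (w (s i) * ω (i.removeNth s))
  map_add' a b := by
    funext s
    simp only [Pi.add_apply, mul_add, Finset.sum_add_distrib]
  map_smul' c a := by
    funext s
    simp only [Pi.smul_apply, smul_eq_mul, RingHom.id_apply, Finset.mul_sum]
    exact Finset.sum_congr rfl fun i _ => by ring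

/-- Contraction: inserting `x` as first argument. -/
def contract (x : V) (n : ℕ) : ((Fin (n + 1) → V) → ℝ) →ₗ[ℝ] ((Fin n → V) → ℝ) :=
  LinearMap.funLeft ℝ ℝ (fun s => (Fin.cons x s : Fin (n + 1) → V))

theorem contract_apply (x : V) {n : ℕ} (ω : (Fin (n + 1) → V) → ℝ) (s : Fin n → V) :
    contract x n ω s = ω (Fin.cons x s) := rfl

theorem tupleDiff_apply (w : V → ℝ) {n : ℕ} (ω : (Fin n → V) → ℝ) (s : Fin (n + 1) → V) :
    tupleDiff w n ω s =
      ∑ i : Fin (n + 1), (-1 : ℝ) ^ (i : ℕ) * (w (s i) * ω (i.removeNth s)) := rfl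

theorem removeNth_succ_cons (x : V) {n : ℕ} (s : Fin (n + 1) → V) (i : Fin (n + 1)) :
    i.succ.removeNth (Fin.cons x s : Fin (n + 2) → V) = Fin.cons x (i.removeNth s) := by
  funext j
  refine Fin.cases ?_ (fun j => ?_) j
  · simp [Fin.removeNth]
  · simp [Fin.removeNth]

/-- A Cartan-type formula: the term omitting the inserted `x` gives `w x • ω`, and every other index
is shifted by one, hence the minus sign. -/
theorem contract_tupleDiff (w : V → ℝ) (x : V) {n : ℕ} (ω : (Fin (n + 1) → V) → ℝ) :
    contract x (n + 1) (tupleDiff w (n + 1) ω) = w x • ω - tupleDiff w n (contract x n ω) := by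
  funext s
  rw [contract_apply, tupleDiff_apply, Fin.sum_univ_succ]
  simp only [removeNth_succ_cons, Fin.cons_zero, Fin.cons_succ, Pi.sub_apply, Pi.smul_apply,
    tupleDiff_apply, contract_apply, Fin.val_zero, Fin.val_succ, pow_succ, pow_zero, smul_eq_mul]
  have h : (0 : Fin (n + 2)).removeNth (Fin.cons x s : Fin (n + 2) → V) = s := by
    funext j
    simp [Fin.removeNth]
  rw [h, sub_eq_add_neg, ← Finset.sum_neg_distrib, one_mul]
  exact congrArg _ (Finset.sum_congr rfl fun i _ => by ring)

theorem contract_tupleDiff_zero (w : V → ℝ) (x : V) (ω : (Fin 0 → V) → ℝ) :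
    contract x 0 (tupleDiff w 0 ω) = w x • ω := by
  funext s
  rw [contract_apply, tupleDiff_apply]
  simp [Subsingleton.elim _ s]

theorem ext_contract {n : ℕ} {ω η : (Fin (n + 1) → V) → ℝ}
    (h : ∀ x, contract x n ω = contract x n η) : ω = η := by
  funext s
  have := congrFun (h (s 0)) (Fin.tail s)
  simpa only [contract_apply, Fin.cons_self_tail] using this

/-- A function is determined by its contractions, so the Cartan formula applied twice reduces the
claim to one argument fewer. -/
theorem tupleDiff_tupleDiff (w : V → ℝ) : ∀ {n : ℕ} (ω : (Fin n → V) → ℝ),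
    tupleDiff w (n + 1) (tupleDiff w n ω) = 0
  | 0, ω => by
    refine ext_contract fun x => ?_
    rw [contract_tupleDiff, contract_tupleDiff_zero, map_smul, sub_self, map_zero]
  | n + 1, ω => by
    refine ext_contract fun x => ?_
    rw [contract_tupleDiff, contract_tupleDiff, map_sub, map_smul, tupleDiff_tupleDiff w,
      sub_zero, sub_self, map_zero]

theorem sign_mul_sign {n : ℕ} (σ : Equiv.Perm (Fin n)) :
    ((Equiv.Perm.sign σ : ℤ) : ℝ) * ((Equiv.Perm.sign σ : ℤ) : ℝ) = 1 := by
  rcases Int.units_eq_one_or (Equiv.Perm.sign σ) with h | h <;> simp [h]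

/-- The permutation `π⁻¹ * ρ` fixes 0, so it is a permutation `e` of the remaining entries, and its
sign is absorbed by the alternation of `ω`. -/
theorem IsAlternating.sign_mul_tail {n : ℕ} {ω : (Fin n → V) → ℝ} (hω : IsAlternating ω)
    (s : Fin (n + 1) → V) {π ρ : Equiv.Perm (Fin (n + 1))} (h : π 0 = ρ 0) :
    ((Equiv.Perm.sign π : ℤ) : ℝ) * ω (fun j => s (π j.succ)) =
      ((Equiv.Perm.sign ρ : ℤ) : ℝ) * ω (fun j => s (ρ j.succ)) := by
  obtain ⟨⟨p, e⟩, hp⟩ := Equiv.Perm.decomposeFin.symm.surjective (π⁻¹ * ρ)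
  have h0 : p = 0 := by
    have := Equiv.Perm.decomposeFin_symm_apply_zero p e
    rw [hp, Equiv.Perm.mul_apply, ← h] at this
    simpa using this.symm
  subst h0
  have hρ : ρ = π * Equiv.Perm.decomposeFin.symm (0, e) := by rw [hp, mul_inv_cancel_left]
  have h1 : ∀ j : Fin n, ρ j.succ = π (e j).succ := fun j => by
    rw [hρ, Equiv.Perm.mul_apply, Equiv.Perm.decomposeFin_symm_apply_succ, Equiv.swap_self,
      Equiv.refl_apply]
  have h2 : Equiv.Perm.sign ρ = Equiv.Perm.sign π * Equiv.Perm.sign e := by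
    rw [hρ, Equiv.Perm.sign_mul, Equiv.Perm.decomposeFin.symm_sign, if_pos rfl, one_mul]
  simp only [h1, h2]
  rw [hω (fun j => s (π j.succ)) e]
  push_cast
  linear_combination (-(Equiv.Perm.sign π : ℤ) * ω (fun j => s (π j.succ))) * sign_mul_sign e

theorem removeNth_eq_cycleRange {n : ℕ} (s : Fin (n + 1) → V) (i : Fin (n + 1)) :
    i.removeNth s = fun j : Fin n => s (i.cycleRange.symm j.succ) := by
  funext j
  rw [Fin.cycleRange_symm_succ]
  rfl

theorem neg_one_pow_eq_sign {n : ℕ} (i : Fin (n + 1)) :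
    (-1 : ℝ) ^ (i : ℕ) = ((Equiv.Perm.sign i.cycleRange.symm : ℤ) : ℝ) := by
  rw [Equiv.Perm.sign_symm, Fin.sign_cycleRange]
  push_cast
  rfl

theorem IsAlternating.tupleDiff {w : V → ℝ} {n : ℕ} {ω : (Fin n → V) → ℝ}
    (hω : IsAlternating ω) : IsAlternating (tupleDiff w n ω) := by
  intro s σ
  simp only [tupleDiff_apply]
  rw [← Equiv.sum_comp σ (fun i => (-1 : ℝ) ^ (i : ℕ) * (w (s i) * ω (i.removeNth s))),
    Finset.mul_sum]
  refine Finset.sum_congr rfl fun i _ => ?_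
  simp only [removeNth_eq_cycleRange, neg_one_pow_eq_sign]
  -- Omitting entry `i` is cycling it to the front and taking the tail; both permutations here send
  -- 0 to `σ i`.
  have h := hω.sign_mul_tail s (π := σ * i.cycleRange.symm) (ρ := (σ i).cycleRange.symm)
    (by simp [Fin.cycleRange_symm_zero])
  rw [Equiv.Perm.sign_mul] at h
  simp only [Equiv.Perm.mul_apply] at h
  push_cast at h
  linear_combination (w (s (σ i)) * ((Equiv.Perm.sign σ : ℤ) : ℝ)) * h -
    (((Equiv.Perm.sign i.cycleRange.symm : ℤ) : ℝ) * w (s (σ i)) *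
      ω (fun j => s (σ (i.cycleRange.symm j.succ)))) * sign_mul_sign σ

end Cochains

/-! ### The augmented cochain complex of a generated subgraph -/

section Complex

variable (G : SimpleGraph V)

/-- The tuple enumerates the vertices of a complete subgraph of the graph generated by `W`. -/
def IsOrdClique (W : Finset V) {n : ℕ} (s : Fin n → V) : Prop :=
  (∀ i, s i ∈ W) ∧ ∀ i j, i ≠ j → G.Adj (s i) (s j)

open Classical in
/-- Restriction of a function of tuples to the simplices of the graph generated by `W`. -/
noncomputable def mask (W : Finset V) (n : ℕ) :
    ((Fin n → V) → ℝ) →ₗ[ℝ] ((Fin n → V) → ℝ) where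
  toFun ω := fun s => if IsOrdClique G W s then ω s else 0
  map_add' a b := by
    funext s
    simp only [Pi.add_apply]
    split_ifs <;> simp
  map_smul' c a := by
    funext s
    simp only [Pi.smul_apply, RingHom.id_apply]
    split_ifs <;> simp

variable {G} {W : Finset V} {n : ℕ}

theorem mask_apply_of_isOrdClique (ω : (Fin n → V) → ℝ) {s : Fin n → V}
    (h : IsOrdClique G W s) : mask G W n ω s = ω s := if_pos h

theorem mask_apply_of_not (ω : (Fin n → V) → ℝ) {s : Fin n → V}
    (h : ¬ IsOrdClique G W s) : mask G W n ω s = 0 := if_neg h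

theorem IsOrdClique.mono {U : Finset V} (hUW : U ⊆ W) {s : Fin n → V}
    (h : IsOrdClique G U s) : IsOrdClique G W s := ⟨fun i => hUW (h.1 i), h.2⟩

theorem IsOrdClique.removeNth {s : Fin (n + 1) → V} (h : IsOrdClique G W s) (i : Fin (n + 1)) :
    IsOrdClique G W (i.removeNth s) :=
  ⟨fun _ => h.1 _, fun _ _ hjk => h.2 _ _ fun e => hjk (Fin.succAbove_right_injective e)⟩

theorem isOrdClique_perm {s : Fin n → V} (σ : Equiv.Perm (Fin n)) :
    IsOrdClique G W (fun i => s (σ i)) ↔ IsOrdClique G W s := by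
  refine ⟨fun h => ⟨fun i => ?_, fun i j hij => ?_⟩,
    fun h => ⟨fun i => h.1 _, fun i j hij => h.2 _ _ fun e => hij (σ.injective e)⟩⟩
  · simpa using h.1 (σ.symm i)
  · simpa using h.2 (σ.symm i) (σ.symm j) fun e => hij (σ.symm.injective e)

theorem isOrdClique_zero (s : Fin 0 → V) : IsOrdClique G W s :=
  ⟨fun i => i.elim0, fun i => i.elim0⟩

theorem mask_mask (ω : (Fin n → V) → ℝ) : mask G W n (mask G W n ω) = mask G W n ω := by
  funext s
  by_cases h : IsOrdClique G W s
  · rw [mask_apply_of_isOrdClique _ h]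
  · rw [mask_apply_of_not _ h, mask_apply_of_not _ h]

theorem mask_mask_of_superset {U : Finset V} (hUW : U ⊆ W) (ω : (Fin n → V) → ℝ) :
    mask G U n (mask G W n ω) = mask G U n ω := by
  funext s
  by_cases h : IsOrdClique G U s
  · rw [mask_apply_of_isOrdClique _ h, mask_apply_of_isOrdClique _ h,
      mask_apply_of_isOrdClique _ (h.mono hUW)]
  · rw [mask_apply_of_not _ h, mask_apply_of_not _ h]

theorem mask_mask_of_subset {U : Finset V} (hUW : U ⊆ W) (ω : (Fin n → V) → ℝ) :
    mask G W n (mask G U n ω) = mask G U n ω := by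
  funext s
  by_cases h : IsOrdClique G W s
  · rw [mask_apply_of_isOrdClique _ h]
  · rw [mask_apply_of_not _ h, mask_apply_of_not _ fun h' => h (h'.mono hUW)]

theorem mask_zero (ω : (Fin 0 → V) → ℝ) : mask G W 0 ω = ω :=
  funext fun s => mask_apply_of_isOrdClique _ (isOrdClique_zero s)

/-- Faces of a clique are cliques, so the differential on cliques never sees the values that were
masked away. -/
theorem mask_tupleDiff_mask (w : V → ℝ) (ω : (Fin n → V) → ℝ) :
    mask G W (n + 1) (tupleDiff w n (mask G W n ω)) = mask G W (n + 1) (tupleDiff w n ω) := by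
  funext s
  by_cases h : IsOrdClique G W s
  · rw [mask_apply_of_isOrdClique _ h, mask_apply_of_isOrdClique _ h]
    simp only [tupleDiff_apply, mask_apply_of_isOrdClique ω (h.removeNth _)]
  · rw [mask_apply_of_not _ h, mask_apply_of_not _ h]

theorem IsAlternating.mask {ω : (Fin n → V) → ℝ} (hω : IsAlternating ω) :
    IsAlternating (mask G W n ω) := by
  intro s σ
  by_cases h : IsOrdClique G W s
  · rw [mask_apply_of_isOrdClique _ h, mask_apply_of_isOrdClique _ ((isOrdClique_perm σ).2 h),
      hω]
  · rw [mask_apply_of_not _ h, mask_apply_of_not _ (mt (isOrdClique_perm σ).1 h), mul_zero]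

variable (G W n)

/-- The alternating cochains of the graph generated by `W` on simplices with `n` vertices,
including the empty simplex for `n = 0`. -/
noncomputable def cochains : Submodule ℝ ((Fin n → V) → ℝ) where
  carrier := {ω | IsAlternating ω ∧ mask G W n ω = ω}
  zero_mem' := ⟨fun s σ => by simp, map_zero _⟩
  add_mem' := fun {a b} ha hb =>
    ⟨fun s σ => by simp only [Pi.add_apply, ha.1 s σ, hb.1 s σ, mul_add],
      by rw [map_add, ha.2, hb.2]⟩
  smul_mem' := fun c {a} ha =>
    ⟨fun s σ => by simp only [Pi.smul_apply, smul_eq_mul, ha.1 s σ]; ring,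
      by rw [map_smul, ha.2]⟩

/-- The coboundary operator of the graph generated by `W`. -/
noncomputable def cliqueDiff : ((Fin n → V) → ℝ) →ₗ[ℝ] ((Fin (n + 1) → V) → ℝ) :=
  mask G W (n + 1) ∘ₗ tupleDiff 1 n

/-- The dimension of the space of cochains. -/
noncomputable def cochainRank : ℕ := Module.finrank ℝ (cochains G W n)

/-- The rank of the coboundary operator on cochains. -/
noncomputable def diffRank : ℕ := Module.finrank ℝ ((cochains G W n).map (cliqueDiff G W n))

variable {G W n}

theorem cliqueDiff_apply (ω : (Fin n → V) → ℝ) :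
    cliqueDiff G W n ω = mask G W (n + 1) (tupleDiff 1 n ω) := rfl

theorem cliqueDiff_mem {ω : (Fin n → V) → ℝ} (hω : IsAlternating ω) :
    cliqueDiff G W n ω ∈ cochains G W (n + 1) :=
  ⟨hω.tupleDiff.mask, mask_mask _⟩

theorem mask_mem {ω : (Fin n → V) → ℝ} (hω : IsAlternating ω) :
    mask G W n ω ∈ cochains G W n :=
  ⟨hω.mask, mask_mask _⟩

theorem cliqueDiff_cliqueDiff (ω : (Fin n → V) → ℝ) :
    cliqueDiff G W (n + 1) (cliqueDiff G W n ω) = 0 := by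
  rw [cliqueDiff_apply, cliqueDiff_apply, mask_tupleDiff_mask, tupleDiff_tupleDiff, map_zero]

theorem finrank_map_add_finrank_inf_ker {E F : Type*} [AddCommGroup E] [Module ℝ E]
    [AddCommGroup F] [Module ℝ F] [FiniteDimensional ℝ E] (p : Submodule ℝ E) (φ : E →ₗ[ℝ] F) :
    Module.finrank ℝ (p.map φ) + Module.finrank ℝ (p ⊓ LinearMap.ker φ : Submodule ℝ E) =
      Module.finrank ℝ p := by
  have h := LinearMap.finrank_range_add_finrank_ker (φ.domRestrict p)
  rw [LinearMap.range_domRestrict, LinearMap.ker_domRestrict] at h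
  rw [← h, ← Submodule.map_comap_subtype, Submodule.finrank_map_subtype_eq]

end Complex

/-! ### Contraction identifies relative cochains with cochains of the unit sphere -/

section AddVertex

variable {G : SimpleGraph V} {W : Finset V} {x : V} {n : ℕ}

theorem isOrdClique_cons [DecidableEq V] [DecidableRel G.Adj] {s : Fin n → V} :
    IsOrdClique G (insert x W) (Fin.cons x s : Fin (n + 1) → V) ↔
      IsOrdClique G (unitSphere G W x) s := by
  constructor
  · rintro ⟨h1, h2⟩
    have hadj : ∀ i, G.Adj x (s i) := fun i => by
      simpa using h2 0 i.succ (Fin.succ_ne_zero i).symm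
    refine ⟨fun i => ?_, fun i j hij => by
      simpa using h2 i.succ j.succ fun e => hij (Fin.succ_injective _ e)⟩
    have h3 := h1 i.succ
    rw [Fin.cons_succ, Finset.mem_insert] at h3
    exact Finset.mem_filter.2 ⟨h3.resolve_left (hadj i).ne', hadj i⟩
  · rintro ⟨h1, h2⟩
    have h3 : ∀ i, s i ∈ W ∧ G.Adj x (s i) := fun i => Finset.mem_filter.1 (h1 i)
    refine ⟨Fin.cases (by simp) fun i => by simp [(h3 i).1], ?_⟩
    refine Fin.cases (Fin.cases (by simp) fun j _ => by simpa using (h3 j).2) fun i => ?_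
    refine Fin.cases (fun _ => by simpa using (h3 i).2.symm) fun j hij => ?_
    simpa using h2 i j fun e => hij (congrArg _ e)

theorem contract_mask [DecidableEq V] [DecidableRel G.Adj] (ω : (Fin (n + 1) → V) → ℝ) :
    contract x n (mask G (insert x W) (n + 1) ω) =
      mask G (unitSphere G W x) n (contract x n ω) := by
  funext s
  rw [contract_apply]
  by_cases h : IsOrdClique G (unitSphere G W x) s
  · rw [mask_apply_of_isOrdClique _ h, mask_apply_of_isOrdClique _ (isOrdClique_cons.2 h),
      contract_apply]
  · rw [mask_apply_of_not _ h, mask_apply_of_not _ (mt isOrdClique_cons.1 h)]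

theorem unitSphere_subset [DecidableRel G.Adj] (W : Finset V) (x : V) : unitSphere G W x ⊆ W :=
  Finset.filter_subset _ _

theorem mask_cliqueDiff [DecidableEq V] (ω : (Fin n → V) → ℝ) :
    mask G W (n + 1) (cliqueDiff G (insert x W) n ω) = cliqueDiff G W n (mask G W n ω) := by
  rw [cliqueDiff_apply, mask_mask_of_superset (Finset.subset_insert x W), cliqueDiff_apply,
    mask_tupleDiff_mask]

theorem IsAlternating.contract {ω : (Fin (n + 1) → V) → ℝ} (hω : IsAlternating ω) :
    IsAlternating (contract x n ω) := by
  intro s σ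
  have h := hω (Fin.cons x s) (Equiv.Perm.decomposeFin.symm (0, σ))
  rw [Equiv.Perm.decomposeFin.symm_sign, if_pos rfl, one_mul] at h
  rw [contract_apply, contract_apply, ← h]
  congr 1
  funext j
  refine Fin.cases ?_ (fun j => ?_) j
  · simp
  · simp [Equiv.Perm.decomposeFin_symm_apply_succ]

theorem contract_mem [DecidableEq V] [DecidableRel G.Adj] {ω : (Fin (n + 1) → V) → ℝ}
    (hω : ω ∈ cochains G (insert x W) (n + 1)) :
    contract x n ω ∈ cochains G (unitSphere G W x) n := by
  refine ⟨hω.1.contract, ?_⟩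
  rw [← contract_mask, hω.2]

/-- A clique containing `x` can be renumbered with `x` in front, where the contraction sees it; any
other clique lies in `W`. -/
theorem eq_zero_of_contract_eq_zero [DecidableEq V] {ω : (Fin (n + 1) → V) → ℝ}
    (hω : ω ∈ cochains G (insert x W) (n + 1)) (hW : mask G W (n + 1) ω = 0)
    (h : contract x n ω = 0) : ω = 0 := by
  funext s
  by_cases hs : IsOrdClique G (insert x W) s
  · by_cases hi : ∃ i, s i = x
    · obtain ⟨i, hi⟩ := hi
      have h1 := hω.1 s i.cycleRange.symm
      have h2 : (fun j => s (i.cycleRange.symm j)) = Fin.cons x (i.removeNth s) := by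
        funext j
        refine Fin.cases ?_ (fun j => ?_) j
        · simp [Fin.cycleRange_symm_zero, hi]
        · simp [Fin.cycleRange_symm_succ, Fin.removeNth]
      have h3 := congrFun h (i.removeNth s)
      rw [contract_apply, ← h2, h1, Pi.zero_apply] at h3
      rcases mul_eq_zero.1 h3 with h4 | h4
      · have := sign_mul_sign i.cycleRange.symm
        rw [h4, zero_mul] at this
        exact absurd this zero_ne_one
      · exact h4
    · push Not at hi
      rw [← mask_apply_of_isOrdClique (G := G) (W := W) ω, hW]
      exact ⟨fun i => (Finset.mem_insert.1 (hs.1 i)).resolve_left (hi i), hs.2⟩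
  · rw [← hω.2, mask_apply_of_not _ hs, Pi.zero_apply]

theorem contract_eq_zero_of_notMem (hx : x ∉ W) {ω : (Fin (n + 1) → V) → ℝ}
    (hω : mask G W (n + 1) ω = ω) : contract x n ω = 0 := by
  funext s
  rw [contract_apply, ← hω, mask_apply_of_not _ fun h => hx (by simpa using h.1 0),
    Pi.zero_apply]

/-- Every cochain of the unit sphere of `x` is the contraction of a cochain of the graph
generated by `W` and `x` which vanishes on `W`. -/
theorem exists_contract_eq [DecidableEq V] [DecidableRel G.Adj] (hx : x ∉ W) {η : (Fin n → V) → ℝ}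
    (hη : η ∈ cochains G (unitSphere G W x) n) :
    ∃ ω ∈ cochains G (insert x W) (n + 1),
      mask G W (n + 1) ω = 0 ∧ contract x n ω = η := by
  -- The exterior product of the indicator of `x` with `η`; the Cartan formula returns `η`, since
  -- `η` vanishes on tuples that start with `x`.
  refine ⟨mask G (insert x W) (n + 1) (tupleDiff (Pi.single x 1) n η),
    mask_mem hη.1.tupleDiff, ?_, ?_⟩
  · rw [mask_mask_of_superset (Finset.subset_insert x W)]
    funext s
    by_cases h : IsOrdClique G W s
    · rw [mask_apply_of_isOrdClique _ h, tupleDiff_apply]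
      refine Finset.sum_eq_zero fun i _ => ?_
      rw [Pi.single_eq_of_ne (fun e : s i = x => hx (e ▸ h.1 i)), zero_mul, mul_zero]
    · rw [mask_apply_of_not _ h, Pi.zero_apply]
  · rw [contract_mask]
    have h : contract x n (tupleDiff (Pi.single x 1) n η) = η := by
      cases n with
      | zero => rw [contract_tupleDiff_zero, Pi.single_eq_same, one_smul]
      | succ n =>
        rw [contract_tupleDiff, Pi.single_eq_same, one_smul,
          contract_eq_zero_of_notMem (fun h => hx (unitSphere_subset W x h)) hη.2, map_zero,
          sub_zero]
    rw [h, hη.2]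

/-- In the Cartan formula the term `ω` drops out, because `ω` vanishes on `W` and hence on the unit
sphere. -/
theorem contract_cliqueDiff [DecidableEq V] [DecidableRel G.Adj] {ω : (Fin (n + 1) → V) → ℝ}
    (hW : mask G W (n + 1) ω = 0) :
    contract x (n + 1) (cliqueDiff G (insert x W) (n + 1) ω) =
      - cliqueDiff G (unitSphere G W x) n (contract x n ω) := by
  rw [cliqueDiff_apply, contract_mask, contract_tupleDiff, map_sub, Pi.one_apply, one_smul,
    ← mask_mask_of_superset (unitSphere_subset W x), hW, map_zero, zero_sub, cliqueDiff_apply]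

end AddVertex

/-! ### Dimension counts for the pair -/

section Ranks

variable {G : SimpleGraph V} {W : Finset V} {x : V} {n : ℕ}

theorem finrank_map_of_inf_ker_eq_bot {E F : Type*} [AddCommGroup E] [Module ℝ E]
    [AddCommGroup F] [Module ℝ F] [FiniteDimensional ℝ E] {p : Submodule ℝ E} {φ : E →ₗ[ℝ] F}
    (h : ∀ a ∈ p, φ a = 0 → a = 0) :
    Module.finrank ℝ (p.map φ) = Module.finrank ℝ p := by
  have hb : p ⊓ LinearMap.ker φ = ⊥ := eq_bot_iff.2 fun a ha => h a ha.1 ha.2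
  rw [← finrank_map_add_finrank_inf_ker p φ, hb, finrank_bot, add_zero]

theorem map_mask_cochains [DecidableEq V] :
    (cochains G (insert x W) n).map (mask G W n) = cochains G W n := by
  refine le_antisymm ?_ fun ω hω => ?_
  · rintro _ ⟨ω, hω, rfl⟩
    exact mask_mem hω.1
  · exact ⟨ω, ⟨hω.1, by rw [← hω.2, mask_mask_of_subset (Finset.subset_insert x W)]⟩, hω.2⟩

theorem cochainRank_zero [Fintype V] : cochainRank G W 0 = 1 := by
  have h : cochains G W 0 = ⊤ := eq_top_iff.2 fun ω _ =>
    ⟨fun s σ => by simp [Subsingleton.elim σ 1], mask_zero ω⟩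
  rw [cochainRank, h, finrank_top, Module.finrank_fintype_fun_eq_card]
  simp

theorem cochainRank_insert [Fintype V] [DecidableEq V] [DecidableRel G.Adj] (hx : x ∉ W) :
    cochainRank G (insert x W) (n + 1) =
      cochainRank G W (n + 1) + cochainRank G (unitSphere G W x) n := by
  have h := finrank_map_add_finrank_inf_ker (cochains G (insert x W) (n + 1)) (mask G W (n + 1))
  have hc := finrank_map_of_inf_ker_eq_bot (φ := contract x n)
    (p := cochains G (insert x W) (n + 1) ⊓ LinearMap.ker (mask G W (n + 1)))
    fun ω hω h0 => eq_zero_of_contract_eq_zero hω.1 hω.2 h0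
  have hm : (cochains G (insert x W) (n + 1) ⊓ LinearMap.ker (mask G W (n + 1))).map
      (contract x n) = cochains G (unitSphere G W x) n := by
    refine le_antisymm ?_ fun η hη => ?_
    · rintro _ ⟨ω, hω, rfl⟩
      exact contract_mem hω.1
    · obtain ⟨ω, h1, h2, h3⟩ := exists_contract_eq hx hη
      exact ⟨ω, ⟨h1, h2⟩, h3⟩
  rw [map_mask_cochains, ← hc, hm] at h
  exact h.symm

theorem diffRank_add_finrank_ker [Fintype V] :
    diffRank G W n + Module.finrank ℝ
      (cochains G W n ⊓ LinearMap.ker (cliqueDiff G W n) : Submodule ℝ _) =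
      cochainRank G W n :=
  finrank_map_add_finrank_inf_ker _ _

theorem map_cliqueDiff_le :
    (cochains G W n).map (cliqueDiff G W n) ≤
      cochains G W (n + 1) ⊓ LinearMap.ker (cliqueDiff G W (n + 1)) := by
  rintro _ ⟨ω, hω, rfl⟩
  exact ⟨cliqueDiff_mem hω.1, cliqueDiff_cliqueDiff ω⟩

theorem diffRank_add_diffRank_le [Fintype V] :
    diffRank G W n + diffRank G W (n + 1) ≤ cochainRank G W (n + 1) := by
  have h : diffRank G W n ≤ _ := Submodule.finrank_mono (map_cliqueDiff_le (G := G) (W := W))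
  rw [← diffRank_add_finrank_ker (n := n + 1)]
  omega

variable (G W x n) in
/-- The coboundaries of the graph generated by `W` and `x` which vanish on `W`. -/
noncomputable def relCoboundaries [DecidableEq V] : Submodule ℝ ((Fin (n + 1) → V) → ℝ) :=
  (cochains G (insert x W) n).map (cliqueDiff G (insert x W) n) ⊓
    LinearMap.ker (mask G W (n + 1))

/-- Rank-nullity for restriction to `W`, which maps the coboundaries of the larger graph onto those
of `W`. -/
theorem diffRank_insert [Fintype V] [DecidableEq V] :
    diffRank G (insert x W) n =
      diffRank G W n + Module.finrank ℝ (relCoboundaries G W x n) := by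
  have h := finrank_map_add_finrank_inf_ker
    ((cochains G (insert x W) n).map (cliqueDiff G (insert x W) n)) (mask G W (n + 1))
  have hc : mask G W (n + 1) ∘ₗ cliqueDiff G (insert x W) n = cliqueDiff G W n ∘ₗ mask G W n :=
    LinearMap.ext fun ω => mask_cliqueDiff ω
  rw [← Submodule.map_comp, hc, Submodule.map_comp, map_mask_cochains] at h
  exact h.symm

/-- Contraction embeds these coboundaries into the cocycles of the unit sphere. -/
theorem finrank_relCoboundaries_add_le [Fintype V] [DecidableEq V] [DecidableRel G.Adj] :
    Module.finrank ℝ (relCoboundaries G W x n) + diffRank G (unitSphere G W x) n ≤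
      cochainRank G (unitSphere G W x) n := by
  have hmem : ∀ ω ∈ relCoboundaries G W x n, ω ∈ cochains G (insert x W) (n + 1) ∧
      cliqueDiff G (insert x W) (n + 1) ω = 0 := fun ω hω => map_cliqueDiff_le hω.1
  have hc := finrank_map_of_inf_ker_eq_bot (φ := contract x n) (p := relCoboundaries G W x n)
    fun ω hω h0 => eq_zero_of_contract_eq_zero (hmem ω hω).1 hω.2 h0
  have hle : (relCoboundaries G W x n).map (contract x n) ≤
      cochains G (unitSphere G W x) n ⊓ LinearMap.ker (cliqueDiff G (unitSphere G W x) n) := by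
    rintro _ ⟨ω, hω, rfl⟩
    refine ⟨contract_mem (hmem ω hω).1, ?_⟩
    have h := contract_cliqueDiff (x := x) hω.2
    rw [(hmem ω hω).2, map_zero] at h
    exact neg_eq_zero.1 h.symm
  have h := Submodule.finrank_mono hle
  rw [← diffRank_add_finrank_ker (n := n)]
  omega

/-- Every coboundary of the unit sphere is the contraction of the coboundary of a cochain vanishing
on `W`. -/
theorem diffRank_le_finrank_relCoboundaries [Fintype V] [DecidableEq V] [DecidableRel G.Adj]
    (hx : x ∉ W) :
    diffRank G (unitSphere G W x) n ≤ Module.finrank ℝ (relCoboundaries G W x (n + 1)) := by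
  refine (Submodule.finrank_mono ?_).trans
    (Submodule.finrank_map_le (contract x (n + 1)) (relCoboundaries G W x (n + 1)))
  rintro _ ⟨η, hη, rfl⟩
  obtain ⟨ω, h1, h2, h3⟩ := exists_contract_eq hx hη
  -- The sign of `-ω` cancels the one in `contract_cliqueDiff`.
  refine ⟨cliqueDiff G (insert x W) (n + 1) (-ω), ⟨⟨-ω, neg_mem h1, rfl⟩, ?_⟩, ?_⟩
  · rw [SetLike.mem_coe, LinearMap.mem_ker, mask_cliqueDiff, map_neg, h2, neg_zero, map_zero]
  · rw [map_neg, map_neg, contract_cliqueDiff h2, h3, neg_neg]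

end Ranks

/-! ### Reduced Betti numbers of contractible graphs and of spheres -/

section Reduced

variable (G : SimpleGraph V) (W : Finset V)

/-- The reduced Betti numbers, indexed by the number of vertices of the simplices. -/
noncomputable def reducedBetti : ℕ → ℤ
  | 0 => cochainRank G W 0 - diffRank G W 0
  | n + 1 => cochainRank G W (n + 1) - diffRank G W (n + 1) - diffRank G W n

variable {G W}

theorem reducedBetti_nonneg [Fintype V] (n : ℕ) : 0 ≤ reducedBetti G W n := by
  cases n with
  | zero =>
    have := diffRank_add_finrank_ker (G := G) (W := W) (n := 0)
    simp only [reducedBetti]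
    omega
  | succ n =>
    have := diffRank_add_diffRank_le (G := G) (W := W) (n := n)
    simp only [reducedBetti]
    omega

/-- Adding a vertex: the numbers `e n` are the ranks of the connecting homomorphisms. -/
theorem exists_reducedBetti_insert [Fintype V] [DecidableEq V] [DecidableRel G.Adj] {x : V}
    (hx : x ∉ W) :
    ∃ e : ℕ → ℤ, (∀ n, 0 ≤ e n ∧ e n ≤ reducedBetti G (unitSphere G W x) n) ∧
      (diffRank G (insert x W) 0 : ℤ) = diffRank G W 0 + e 0 ∧
      reducedBetti G (insert x W) 0 = reducedBetti G W 0 - e 0 ∧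
      ∀ n, reducedBetti G (insert x W) (n + 1) =
        reducedBetti G W (n + 1) + reducedBetti G (unitSphere G W x) n - e (n + 1) - e n := by
  set S := unitSphere G W x
  have hb : ∀ n, Module.finrank ℝ (relCoboundaries G W x n) + diffRank G S n ≤
    cochainRank G S n := fun n => finrank_relCoboundaries_add_le
  have hc : ∀ n, diffRank G S n ≤ Module.finrank ℝ (relCoboundaries G W x (n + 1)) :=
    fun n => diffRank_le_finrank_relCoboundaries hx
  have hr : ∀ n, diffRank G (insert x W) n =
    diffRank G W n + Module.finrank ℝ (relCoboundaries G W x n) := fun n => diffRank_insert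
  have hC : ∀ n, cochainRank G (insert x W) (n + 1) =
    cochainRank G W (n + 1) + cochainRank G S n := fun n => cochainRank_insert hx
  have h0 : cochainRank G (insert x W) 0 = cochainRank G W 0 := by
    rw [cochainRank_zero, cochainRank_zero]
  -- The subtracted rank accounts for coboundaries of cochains vanishing on `W`; for `n = 0` there
  -- are none, as the empty simplex lies in `W`.
  obtain ⟨e, he0, he⟩ : ∃ e : ℕ → ℤ, e 0 = Module.finrank ℝ (relCoboundaries G W x 0) ∧
      ∀ n, e (n + 1) = Module.finrank ℝ (relCoboundaries G W x (n + 1)) - diffRank G S n :=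
    ⟨fun | 0 => _ | n + 1 => _, rfl, fun _ => rfl⟩
  refine ⟨e, ?_, ?_, ?_, ?_⟩
  · rintro (_ | n)
    · have := hb 0
      simp only [reducedBetti]
      omega
    · have := hb (n + 1)
      have := hc n
      have := he n
      simp only [reducedBetti]
      omega
  · have := hr 0
    omega
  · have := hr 0
    simp only [reducedBetti]
    omega
  · intro n
    have := hr n
    have := hr (n + 1)
    have := hC n
    have := he n
    cases n with
    | zero =>
      simp only [reducedBetti]
      omega
    | succ n =>
      have := he n
      simp only [reducedBetti]
      omega

theorem cochains_empty (n : ℕ) : cochains G ∅ (n + 1) = ⊥ := by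
  refine eq_bot_iff.2 fun ω hω => ?_
  rw [Submodule.mem_bot, ← hω.2]
  exact funext fun s => mask_apply_of_not _ fun h => Finset.notMem_empty _ (h.1 0)

theorem cochainRank_empty (n : ℕ) : cochainRank G ∅ (n + 1) = 0 := by
  rw [cochainRank, cochains_empty, finrank_bot]

theorem diffRank_empty (n : ℕ) : diffRank G ∅ n = 0 := by
  have h : (cochains G ∅ n).map (cliqueDiff G ∅ n) = ⊥ := by
    rw [eq_bot_iff, ← cochains_empty (G := G) n]
    rintro _ ⟨ω, hω, rfl⟩
    exact cliqueDiff_mem hω.1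
  rw [diffRank, h, finrank_bot]

theorem reducedBetti_empty [Fintype V] (n : ℕ) :
    reducedBetti G ∅ n = if n = 0 then 1 else 0 := by
  cases n with
  | zero => simp [reducedBetti, cochainRank_zero, diffRank_empty]
  | succ n => simp [reducedBetti, cochainRank_empty, diffRank_empty]

theorem diffRank_zero_pos [Fintype V] {v : V} (hv : v ∈ W) : 0 < diffRank G W 0 := by
  refine Nat.pos_of_ne_zero fun h => ?_
  have hb := Submodule.finrank_eq_zero.1 h
  have h1 : cliqueDiff G W 0 (fun _ => 1) ∈ (cochains G W 0).map (cliqueDiff G W 0) :=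
    ⟨_, ⟨fun s σ => by simp [Subsingleton.elim σ 1], mask_zero _⟩, rfl⟩
  rw [hb, Submodule.mem_bot] at h1
  have h2 := congrFun h1 fun _ => v
  rw [cliqueDiff_apply, mask_apply_of_isOrdClique] at h2
  · simp [tupleDiff_apply] at h2
  · exact ⟨fun _ => hv, fun i j hij => absurd (Subsingleton.elim (α := Fin 1) i j) hij⟩

theorem unitSphere_erase [DecidableEq V] [DecidableRel G.Adj] (v : V) :
    unitSphere G (W.erase v) v = unitSphere G W v := by
  ext y
  simp only [unitSphere, Finset.mem_filter, Finset.mem_erase]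
  exact ⟨fun h => ⟨h.1.2, h.2⟩, fun h => ⟨⟨h.2.ne', h.1⟩, h.2⟩⟩

theorem IsContractible.reducedBetti_eq_zero [Fintype V] [DecidableEq V] [DecidableRel G.Adj]
    (h : IsContractible G W) (n : ℕ) : reducedBetti G W n = 0 := by
  induction h generalizing n with
  | point v =>
    obtain ⟨e, h1, h2, h3, h4⟩ := exists_reducedBetti_insert (G := G) (Finset.notMem_empty v)
    have hpos := diffRank_zero_pos (G := G) (Finset.mem_singleton_self v)
    have hS : unitSphere G ∅ v = ∅ := rfl
    rw [hS] at h1 h4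
    simp only [reducedBetti_empty, LawfulSingleton.insert_empty_eq, diffRank_empty] at h1 h2 h3 h4
    have h10 := h1 0
    -- The unit sphere is empty, so only `e 0` can survive; it equals 1, because the empty simplex
    -- has nonzero coboundary once there is a vertex.
    have he : ∀ k, e (k + 1) = 0 := fun k => by
      have h11 := h1 (k + 1)
      rw [if_neg (Nat.succ_ne_zero k)] at h11
      exact le_antisymm h11.2 h11.1
    have he0 : e 0 = 1 := by
      rw [if_pos rfl] at h10
      omega
    rcases n with _ | _ | n
    · simp [h3, he0]
    · simp [h4, he0, he]
    · simp [h4, he]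
  | step W v hv _ _ ihS ihW =>
    obtain ⟨e, h1, -, h3, h4⟩ := exists_reducedBetti_insert (G := G) (Finset.notMem_erase v W)
    rw [unitSphere_erase] at h1 h4
    rw [Finset.insert_erase hv] at h3 h4
    simp only [ihS] at h1
    cases n with
    | zero => rw [h3, ihW, le_antisymm (h1 0).2 (h1 0).1, sub_zero]
    | succ n =>
      rw [h4, ihW, ihS, le_antisymm (h1 _).2 (h1 _).1, le_antisymm (h1 _).2 (h1 _).1]
      norm_num

theorem IsSphere.reducedBetti_eq [Fintype V] [DecidableEq V] [DecidableRel G.Adj] {m : ℕ}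
    (h : IsSphere G m W) (n : ℕ) : reducedBetti G W n = if n = m then 1 else 0 := by
  induction m generalizing W n with
  | zero =>
    rw [IsSphere] at h
    rw [h, reducedBetti_empty]
  | succ m ih =>
    rw [IsSphere] at h
    obtain ⟨hS, v, hv, hW⟩ := h
    obtain ⟨e, h1, -, h3, h4⟩ := exists_reducedBetti_insert (G := G) (Finset.notMem_erase v W)
    rw [unitSphere_erase] at h1 h4
    rw [Finset.insert_erase hv] at h3 h4
    simp only [ih (hS v hv), hW.reducedBetti_eq_zero] at h1 h3 h4
    -- Off `k = m` the sphere of `v` bounds `e k` by 0. At `k = m` the contractible rest contributes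
    -- no class, so a positive `e m` would make a reduced Betti number negative.
    have he : ∀ k, e k = 0 := fun k => by
      have hk := h1 k
      by_cases hkm : k = m
      · have hnn := reducedBetti_nonneg (G := G) (W := W) k
        cases k with
        | zero => omega
        | succ k =>
          rw [h4, if_neg (by omega)] at hnn
          have := h1 k
          omega
      · rw [if_neg hkm] at hk
        omega
    cases n with
    | zero => rw [h3, he, if_neg (Nat.succ_ne_zero m).symm, sub_zero]
    | succ n => simp [h4, he]

end Reduced

/-! ### Comparison with the cohomology of forms on ordered simplices -/

section Betti

variable (G : SimpleGraph V) (W : Finset V)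

/-- Restriction of functions of tuples to ordered simplices. -/
def toOrdSimplex (k : ℕ) : ((Fin (k + 1) → V) → ℝ) →ₗ[ℝ] (OrdSimplex G W k → ℝ) :=
  LinearMap.funLeft ℝ ℝ fun s => s.1

variable {G W} {k : ℕ}

theorem toOrdSimplex_apply (ω : (Fin (k + 1) → V) → ℝ) (s : OrdSimplex G W k) :
    toOrdSimplex G W k ω s = ω s.1 := rfl

theorem eq_zero_of_toOrdSimplex_eq_zero {ω : (Fin (k + 1) → V) → ℝ}
    (hω : ω ∈ cochains G W (k + 1)) (h : toOrdSimplex G W k ω = 0) : ω = 0 := by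
  funext s
  by_cases hs : IsOrdClique G W s
  · exact congrFun h ⟨s, hs⟩
  · rw [← hω.2, mask_apply_of_not _ hs, Pi.zero_apply]

theorem toOrdSimplex_cliqueDiff (ω : (Fin (k + 1) → V) → ℝ) :
    toOrdSimplex G W (k + 1) (cliqueDiff G W (k + 1) ω) =
      exteriorDerivative G W k (toOrdSimplex G W k ω) := by
  funext s
  rw [toOrdSimplex_apply, cliqueDiff_apply, mask_apply_of_isOrdClique _ s.2, tupleDiff_apply]
  exact Finset.sum_congr rfl fun i _ => congrArg _ (one_mul _)

theorem map_toOrdSimplex_cochains :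
    (cochains G W (k + 1)).map (toOrdSimplex G W k) = forms G W k := by
  classical
  refine le_antisymm ?_ fun α hα => ?_
  · rintro _ ⟨ω, hω, rfl⟩ s σ
    exact hω.1 s.1 σ
  · refine ⟨fun s => if h : IsOrdClique G W s then α ⟨s, h⟩ else 0, ⟨fun s σ => ?_, ?_⟩, ?_⟩
    · by_cases h : IsOrdClique G W s
      · simp only [dif_pos h, dif_pos ((isOrdClique_perm σ).2 h)]
        exact hα ⟨s, h⟩ σ
      · simp only [dif_neg h, dif_neg (mt (isOrdClique_perm σ).1 h), mul_zero]
    · funext s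
      by_cases h : IsOrdClique G W s
      · rw [mask_apply_of_isOrdClique _ h]
      · rw [mask_apply_of_not _ h, dif_neg h]
    · funext s
      exact dif_pos s.2

theorem map_toOrdSimplex_inf_ker :
    (cochains G W (k + 1) ⊓ LinearMap.ker (cliqueDiff G W (k + 1))).map (toOrdSimplex G W k) =
      cocycles G W k := by
  refine le_antisymm ?_ ?_
  · rintro _ ⟨ω, hω, rfl⟩
    refine ⟨map_toOrdSimplex_cochains.le ⟨ω, hω.1, rfl⟩, ?_⟩
    rw [SetLike.mem_coe, LinearMap.mem_ker, ← toOrdSimplex_cliqueDiff, hω.2, map_zero]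
  · rintro α ⟨hα, hd⟩
    obtain ⟨ω, hω, rfl⟩ := map_toOrdSimplex_cochains.ge hα
    rw [SetLike.mem_coe, LinearMap.mem_ker, ← toOrdSimplex_cliqueDiff] at hd
    exact ⟨ω, ⟨hω, eq_zero_of_toOrdSimplex_eq_zero (cliqueDiff_mem hω.1) hd⟩, rfl⟩

theorem map_toOrdSimplex_map :
    ((cochains G W (k + 1)).map (cliqueDiff G W (k + 1))).map (toOrdSimplex G W (k + 1)) =
      coboundaries G W (k + 1) := by
  have h : toOrdSimplex G W (k + 1) ∘ₗ cliqueDiff G W (k + 1) =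
      exteriorDerivative G W k ∘ₗ toOrdSimplex G W k :=
    LinearMap.ext fun ω => toOrdSimplex_cliqueDiff ω
  rw [← Submodule.map_comp, h, Submodule.map_comp, map_toOrdSimplex_cochains, coboundaries]

theorem coboundaries_le_cocycles : ∀ k, coboundaries G W k ≤ cocycles G W k
  | 0 => bot_le
  | k + 1 => by
    rw [← map_toOrdSimplex_map, ← map_toOrdSimplex_inf_ker]
    exact Submodule.map_mono map_cliqueDiff_le

variable [Fintype V]

theorem finrank_cocycles_add : Module.finrank ℝ (cocycles G W k) + diffRank G W (k + 1) =
    cochainRank G W (k + 1) := by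
  have h := finrank_map_of_inf_ker_eq_bot (φ := toOrdSimplex G W k)
    (p := cochains G W (k + 1) ⊓ LinearMap.ker (cliqueDiff G W (k + 1)))
    fun ω hω h => eq_zero_of_toOrdSimplex_eq_zero hω.1 h
  rw [← map_toOrdSimplex_inf_ker, h, add_comm, diffRank_add_finrank_ker]

theorem finrank_coboundaries_succ :
    Module.finrank ℝ (coboundaries G W (k + 1)) = diffRank G W (k + 1) := by
  have h := finrank_map_of_inf_ker_eq_bot (φ := toOrdSimplex G W (k + 1))
    (p := (cochains G W (k + 1)).map (cliqueDiff G W (k + 1)))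
    fun ω hω h => eq_zero_of_toOrdSimplex_eq_zero (map_cliqueDiff_le hω).1 h
  rw [← map_toOrdSimplex_map, h, diffRank]

theorem betti_add_finrank_coboundaries (k : ℕ) :
    betti G W k + Module.finrank ℝ (coboundaries G W k) =
      Module.finrank ℝ (cocycles G W k) := by
  have : Finite (OrdSimplex G W k) := Subtype.finite
  rw [← (Submodule.submoduleOfEquivOfLe (coboundaries_le_cocycles k)).finrank_eq]
  exact Submodule.finrank_quotient_add_finrank _

/-- In degree 0 the reduced count also divides out the image of the empty simplex, which must be
added back. -/
theorem betti_zero_eq : (betti G W 0 : ℤ) = reducedBetti G W 1 + diffRank G W 0 := by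
  have h1 := betti_add_finrank_coboundaries (G := G) (W := W) 0
  have h2 := finrank_cocycles_add (G := G) (W := W) (k := 0)
  have h3 : Module.finrank ℝ (coboundaries G W 0) = 0 := finrank_bot ℝ _
  simp only [reducedBetti]
  omega

theorem betti_succ_eq (k : ℕ) : (betti G W (k + 1) : ℤ) = reducedBetti G W (k + 2) := by
  have h1 := betti_add_finrank_coboundaries (G := G) (W := W) (k + 1)
  have h2 := finrank_cocycles_add (G := G) (W := W) (k := k + 1)
  have h3 := finrank_coboundaries_succ (G := G) (W := W) (k := k)
  simp only [reducedBetti]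
  omega

theorem betti_empty (k : ℕ) : betti G ∅ k = 0 := by
  cases k with
  | zero =>
    have h := betti_zero_eq (G := G) (W := ∅)
    rw [reducedBetti_empty, diffRank_empty, if_neg one_ne_zero] at h
    exact_mod_cast h
  | succ k =>
    have h := betti_succ_eq (G := G) (W := ∅) k
    rw [reducedBetti_empty, if_neg (Nat.succ_ne_zero _)] at h
    exact_mod_cast h

/-- Adding a vertex with a spherical unit sphere changes exactly one Betti number. -/
theorem exists_betti_insert [DecidableEq V] [DecidableRel G.Adj] {x : V} (hx : x ∉ W) {m : ℕ}
    (hS : IsSphere G m (unitSphere G W x)) :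
    ∃ j : ℕ, ((betti G (insert x W) j = betti G W j + 1 ∧ m = j) ∨
        (betti G (insert x W) j + 1 = betti G W j ∧ m = j + 1)) ∧
      ∀ i : ℕ, i ≠ j → betti G (insert x W) i = betti G W i := by
  obtain ⟨e, h1, h2, h3, h4⟩ := exists_reducedBetti_insert (G := G) hx
  simp only [hS.reducedBetti_eq] at h1 h4
  have he : ∀ k, k ≠ m → e k = 0 := fun k hk => by
    have := h1 k
    rw [if_neg hk] at this
    exact le_antisymm this.2 this.1
  have hem := h1 m
  rw [if_pos rfl] at hem
  -- The change `e 0` of `diffRank` cancels the `- e 0` of the reduced count.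
  have hb0 : (betti G (insert x W) 0 : ℤ) = betti G W 0 + (if 0 = m then 1 else 0) - e 1 := by
    rw [betti_zero_eq, betti_zero_eq, h2, h4]
    ring
  have hb : ∀ k, (betti G (insert x W) (k + 1) : ℤ) =
      betti G W (k + 1) + (if k + 1 = m then 1 else 0) - e (k + 2) - e (k + 1) := fun k => by
    rw [betti_succ_eq, betti_succ_eq, h4]
  cases m with
  | zero =>
    refine ⟨0, Or.inl ⟨?_, rfl⟩, fun i hi => ?_⟩
    · rw [he 1 one_ne_zero, if_pos rfl] at hb0
      omega
    · obtain ⟨i, rfl⟩ := Nat.exists_eq_succ_of_ne_zero hi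
      have := hb i
      rw [he _ (Nat.succ_ne_zero _), he _ (Nat.succ_ne_zero _),
        if_neg (Nat.succ_ne_zero _)] at this
      simp only [Nat.succ_eq_add_one]
      omega
  | succ m =>
    -- The dichotomy of the theorem: rank 0 creates a class in degree `m + 1`, rank 1 kills one in
    -- degree `m`.
    have hcase : e (m + 1) = 0 ∨ e (m + 1) = 1 := by omega
    rcases hcase with h | h
    · have hz : ∀ k, e k = 0 := fun k => by
        by_cases hk : k = m + 1
        · rw [hk, h]
        · exact he k hk
      refine ⟨m + 1, Or.inl ⟨?_, rfl⟩, fun i hi => ?_⟩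
      · have := hb m
        rw [hz, hz, if_pos rfl] at this
        omega
      · cases i with
        | zero =>
          rw [hz, if_neg hi] at hb0
          omega
        | succ i =>
          have := hb i
          rw [hz, hz, if_neg hi] at this
          omega
    · refine ⟨m, Or.inr ⟨?_, rfl⟩, fun i hi => ?_⟩
      · cases m with
        | zero =>
          rw [h, if_neg (by omega)] at hb0
          omega
        | succ m =>
          have := hb m
          rw [h, he (m + 1) (by omega), if_neg (by omega)] at this
          omega
      · cases i with
        | zero =>
          rw [he 1 (by omega), if_neg (by omega)] at hb0
          omega
        | succ i =>
          have := hb i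
          rw [he (i + 2) (by omega)] at this
          by_cases him : i = m
          · rw [him, h, if_pos rfl] at this
            rw [him]
            omega
          · rw [he (i + 1) (by omega), if_neg (by omega)] at this
            omega

end Betti

/-! ### Inductive dimension of spheres and cones -/

section Dimension

variable {G : SimpleGraph V} [DecidableRel G.Adj]

theorem dim_empty : dim G ∅ = -1 := by
  rw [dim, if_pos Finset.card_empty]

theorem dim_of_nonempty {W : Finset V} (h : W.Nonempty) :
    dim G W = 1 + (∑ x ∈ W, dim G (unitSphere G W x)) / W.card := by
  rw [dim, if_neg h.card_pos.ne', ← Finset.sum_coe_sort W fun x => dim G (unitSphere G W x)]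

theorem IsSphere.dim_eq [DecidableEq V] {m : ℕ} {W : Finset V} (h : IsSphere G m W) :
    dim G W = m - 1 := by
  induction m generalizing W with
  | zero =>
    rw [IsSphere] at h
    rw [h, dim_empty]
    norm_num
  | succ m ih =>
    rw [IsSphere] at h
    obtain ⟨hS, v, hv, -⟩ := h
    have hc : (W.card : ℚ) ≠ 0 := Nat.cast_ne_zero.2 (Finset.card_pos.2 ⟨v, hv⟩).ne'
    rw [dim_of_nonempty ⟨v, hv⟩, Finset.sum_congr rfl fun x hx => ih (hS x hx),
      Finset.sum_const, nsmul_eq_mul]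
    field_simp
    push_cast
    ring

/-- A cone has dimension one more than its base. -/
theorem dim_insert [DecidableEq V] {x : V} {S : Finset V} (h : ∀ y ∈ S, G.Adj x y) :
    dim G (insert x S) = dim G S + 1 := by
  induction hn : S.card using Nat.strong_induction_on generalizing S with
  | _ n ih =>
    have hx : x ∉ S := fun hx => G.irrefl (h x hx)
    have h1 : unitSphere G (insert x S) x = S := by
      rw [unitSphere, Finset.filter_insert, if_neg G.irrefl, Finset.filter_true_of_mem h]
    -- In the cone, the unit sphere of `y` is the cone with apex `x` over its unit sphere in `S`,
    -- which is smaller.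
    have h2 : ∀ y ∈ S, dim G (unitSphere G (insert x S) y) = dim G (unitSphere G S y) + 1 := by
      intro y hy
      rw [unitSphere, Finset.filter_insert, if_pos (h y hy).symm]
      exact ih _ (hn ▸ card_unitSphere_lt G hy)
        (fun z hz => h z (Finset.mem_filter.1 hz).1) rfl
    rw [dim_of_nonempty (Finset.insert_nonempty x S), Finset.sum_insert hx, h1,
      Finset.sum_congr rfl h2, Finset.sum_add_distrib, Finset.sum_const,
      Finset.card_insert_of_notMem hx]
    rcases S.eq_empty_or_nonempty with rfl | hS
    · simp [dim_empty]
    · have hc : (S.card : ℚ) ≠ 0 := Nat.cast_ne_zero.2 hS.card_pos.ne'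
      have hc' : (S.card : ℚ) + 1 ≠ 0 := by positivity
      have hd := dim_of_nonempty (G := G) hS
      have hs : ∑ y ∈ S, dim G (unitSphere G S y) = (dim G S - 1) * S.card := by
        rw [hd]
        field_simp
        ring
      rw [hs, nsmul_eq_mul]
      push_cast
      field_simp
      ring

end Dimension

/-! ### The Morse filtration -/

section Morse

variable [Fintype V] {G : SimpleGraph V} [DecidableRel G.Adj] {f : V → ℝ}

/-- Vertices of `W` at the same level as `x` are not adjacent to `x`, by local injectivity. -/
theorem unitSphere_eq_stableSphere (hf : ∀ x y, G.Adj x y → f x ≠ f y) {x : V} {W : Finset V}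
    (h1 : ∀ y, f y < f x → y ∈ W) (h2 : ∀ y ∈ W, f y ≤ f x) :
    unitSphere G W x = stableSphere G f x := by
  ext y
  simp only [unitSphere, stableSphere, Finset.mem_filter, Finset.mem_univ, true_and]
  exact ⟨fun h => ⟨h.2, lt_of_le_of_ne (h2 y h.1) (hf x y h.2).symm⟩, fun h => ⟨h1 y h.2, h.1⟩⟩

theorem morseIndex_eq [DecidableEq V] {x : V} {m : ℕ} (h : IsSphere G m (stableSphere G f x)) :
    morseIndex G f x = m := by
  rw [morseIndex, stableBall, dim_insert, h.dim_eq, sub_add_cancel]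
  intro y hy
  simp only [unitSphere, stableSphere, Finset.mem_filter, Finset.mem_univ, true_and] at hy
  exact hy.1

theorem exists_betti_insert_of_isMorse [DecidableEq V] (hf : IsMorse G f) {x : V} {W : Finset V}
    (h1 : ∀ y, f y < f x → y ∈ W) (h2 : ∀ y ∈ W, f y ≤ f x) (hx : x ∉ W) :
    ∃ j : ℕ, ((betti G (insert x W) j = betti G W j + 1 ∧ morseIndex G f x = (j : ℚ)) ∨
        (betti G (insert x W) j + 1 = betti G W j ∧ morseIndex G f x = (j : ℚ) + 1)) ∧
      ∀ i : ℕ, i ≠ j → betti G (insert x W) i = betti G W i := by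
  obtain ⟨m, hm⟩ := hf.2 x
  have hS := hm
  rw [← unitSphere_eq_stableSphere hf.1 h1 h2] at hS
  obtain ⟨j, hj, hi⟩ := exists_betti_insert hx hS
  refine ⟨j, ?_, hi⟩
  rw [morseIndex_eq hm]
  rcases hj with ⟨h, rfl⟩ | ⟨h, rfl⟩
  · exact Or.inl ⟨h, rfl⟩
  · exact Or.inr ⟨h, Nat.cast_succ j⟩

/-- Induction that removes a vertex with maximal `f`: the `k`-th Betti number grows only when the
vertex has index `k`, and then by one. -/
theorem betti_le_card_of_isMorse [DecidableEq V] (hf : IsMorse G f) (k : ℕ) (W : Finset V)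
    (hW : ∀ x ∈ W, ∀ y, f y < f x → y ∈ W) :
    betti G W k ≤ (W.filter fun x => morseIndex G f x = k).card := by
  induction W using Finset.induction_on_max_value f with
  | empty => rw [betti_empty]; exact Nat.zero_le _
  | insert x W hx hmax ih =>
    have h1 : ∀ y, f y < f x → y ∈ W := fun y hy =>
      (Finset.mem_insert.1 (hW x (Finset.mem_insert_self x W) y hy)).resolve_left
        fun e => hy.ne (congrArg f e)
    have ih' := ih fun z hz y hy => h1 y (hy.trans_le (hmax z hz))
    obtain ⟨j, hj, hi⟩ := exists_betti_insert_of_isMorse hf h1 hmax hx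
    have hle := Finset.card_le_card
      (Finset.filter_subset_filter (fun x => morseIndex G f x = k) (Finset.subset_insert x W))
    by_cases hkj : k = j
    · subst hkj
      rcases hj with ⟨hb, hm⟩ | ⟨hb, -⟩
      · rw [Finset.filter_insert, if_pos hm,
          Finset.card_insert_of_notMem fun h => hx (Finset.mem_filter.1 h).1]
        omega
      · omega
    · rw [hi k hkj]
      exact ih'.trans hle

theorem criticalCount_eq_card [DecidableEq V] (hf : IsMorse G f) (k : ℕ) :
    criticalCount G f k = (Finset.univ.filter fun x => morseIndex G f x = k).card := by
  rw [criticalCount, ← Set.ncard_coe_finset]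
  congr 1
  ext x
  simp [hf.2 x]

end Morse

end MorseGraph

/-- The weak Morse inequalities `b_k ≤ c_k`; moreover, when the vertices are added in an order of
nondecreasing `f`, each vertex `x` of Morse index `m` changes exactly one Betti number: either
`b_m` increases by one or `b_{m-1}` decreases by one. -/
theorem mainTheorem4 {V : Type*} [Fintype V] [DecidableEq V] (G : SimpleGraph V)
    [DecidableRel G.Adj] (f : V → ℝ) (hf : MorseGraph.IsMorse G f) :
    (∀ k : ℕ, MorseGraph.betti G Finset.univ k ≤ MorseGraph.criticalCount G f k) ∧
    (∀ (x : V) (W : Finset V), (∀ y, f y < f x → y ∈ W) → (∀ y ∈ W, f y ≤ f x) → x ∉ W →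
      ∃ j : ℕ,
        ((MorseGraph.betti G (insert x W) j = MorseGraph.betti G W j + 1 ∧
            MorseGraph.morseIndex G f x = (j : ℚ)) ∨
          (MorseGraph.betti G (insert x W) j + 1 = MorseGraph.betti G W j ∧
            MorseGraph.morseIndex G f x = (j : ℚ) + 1)) ∧
        ∀ i : ℕ, i ≠ j → MorseGraph.betti G (insert x W) i = MorseGraph.betti G W i) := by
  refine ⟨fun k => ?_, fun x W h1 h2 hx =>
    MorseGraph.exists_betti_insert_of_isMorse hf h1 h2 hx⟩
  rw [MorseGraph.criticalCount_eq_card hf]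
  exact MorseGraph.betti_le_card_of_isMorse hf k Finset.univ fun _ _ y _ => Finset.mem_univ y
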